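/- All rings are commutative with identity. Let $R=\bigoplus_{n\ge 0}R_n$ be an $\mathbb N$-graded ring with $R_0=k$ a field. Assume that $R$ is a Hilbert–Serre ring, that is: 1. $\dim_k R_n<\infty$ for all $n\in\mathbb N$; 2. the Poincaré series $P_R(t)=\sum_{n\ge 0}(\dim_k R_n)\,t^n$ has radius of convergence at least $1$ (it is then equal to $1$ unless $R_n=0$ for all sufficiently large $n$); 3. the set $D$ of all $d\in\mathbb N$ for which $\lim_{t\to 1^-}(1-t)^dP_R(t)$ exists and is finite is not empty. Put $d(R)=\min D$. Let $\dim(R)$ be the Krull dimension of $R$, and let $$\operatorname{GKdim}_k(R)=\sup_V\ \limsup_{n\to\infty}\frac{\log\bigl(\dim_k(k+V+\cdots+V^n)\bigr)}{\log n}$$ be the Gelfand–Kirillov dimension of $R$, where $V$ ranges over all finite-dimensional $k$-subspaces of $R$ and $V^i$ is the $k$-subspace spanned by all products of $i$ elements of $V$. Then $$\dim(R)\le \operatorname{GKdim}_k(R)\le d(R).$$ If moreover $R$ is a domain, then $$\dim(R)\le \operatorname{trdeg}_k(R)=\operatorname{GKdim}_k(R)\le d(R),$$ where $\operatorname{trdeg}_k(R)$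 is the transcendence degree of $R$ over $k$. -/

import Mathlib

open Filter Topology
open scoped ENNReal

namespace HilbertSerre

noncomputable section

variable (k : Type*) {R : Type*} [Field k] [CommRing R] [Algebra k R]

/-- The `n`-th coefficient `dim_k R_n` of the Poincaré series of `R = ⨁ R_n`, as a real number. -/
def hilbertCoeff (𝒜 : ℕ → Submodule k R) (n : ℕ) : ℝ :=
  (Module.finrank k (𝒜 n) : ℝ)

/-- The value `P_R(t) = ∑ (dim_k R_n) t ^ n` of the Poincaré series at a real number `t`.
It is only used where the series converges. -/
def poincareSeries (𝒜 : ℕ → Submodule k R) (t : ℝ) : ℝ :=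
  ∑' n : ℕ, hilbertCoeff k 𝒜 n * t ^ n

/-- The set of all natural numbers `d` for which `(1 - t) ^ d * P_R(t)` has a finite limit
as `t` tends to `1` from the left. -/
def poleOrders (𝒜 : ℕ → Submodule k R) : Set ℕ :=
  {d | ∃ L : ℝ, Tendsto (fun t : ℝ => (1 - t) ^ d * poincareSeries k 𝒜 t) (𝓝[<] 1) (𝓝 L)}

/-- The conditions that make the graded ring `R = ⨁ R_n` with `R_0 = k` a Hilbert-Serre ring.
The radius of convergence of the Poincaré series is required to be at least `1`: it equals `1`
unless `R_n = 0` for all large `n`, in which case the series is a polynomial. -/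
structure IsHilbertSerre (𝒜 : ℕ → Submodule k R) : Prop where
  finiteDimensional : ∀ n, FiniteDimensional k (𝒜 n)
  one_le_radius : 1 ≤ (FormalMultilinearSeries.ofScalars ℝ (hilbertCoeff k 𝒜)).radius
  poleOrders_nonempty : (poleOrders k 𝒜).Nonempty

/-- The Hilbert-Serre dimension `d(R)`: the least element of `poleOrders`. -/
def hilbertSerreDim (𝒜 : ℕ → Submodule k R) : ℕ :=
  sInf (poleOrders k 𝒜)

/-- The growth function `d_V(n) = dim_k (k + V + ⋯ + V ^ n)` of a subspace `V` of `R`.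
Here `V ^ i` is the span of all products of `i` elements of `V`, and `V ^ 0 = k`. -/
def growth (V : Submodule k R) (n : ℕ) : ℕ :=
  Module.finrank k (∑ i ∈ Finset.range (n + 1), V ^ i : Submodule k R)

variable (R)

/-- The Gelfand-Kirillov dimension of `R` over `k`: the supremum over all finite-dimensional
subspaces `V` of `limsup (log (d_V(n)) / log n)`, in the extended reals. -/
def gkDim : EReal :=
  ⨆ (V : Submodule k R) (_ : FiniteDimensional k V),
    limsup (fun n : ℕ => ((Real.log (growth k V n) / Real.log n : ℝ) : EReal)) atTop

/-- The transcendence degree of `R` over `k` in the extended reals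
(every infinite cardinal becomes `⊤`). -/
def trdegE : EReal :=
  (((Cardinal.toENat (Algebra.trdeg k R) : ℕ∞) : ℝ≥0∞) : EReal)

/-- The Krull dimension of a ring in the extended reals (`⊥` for the zero ring). -/
def krullDimE (S : Type*) [CommRing S] : EReal :=
  WithBot.recBotCoe ⊥ (fun n : ℕ∞ => ((n : ℝ≥0∞) : EReal)) (ringKrullDim S)

end

end HilbertSerre

/-!
A strict chain of `n + 1` primes of `R` yields `n` algebraically independent elements: pick an
element of each prime outside the previous one, and argue by lowest-order terms. Hence
`dim R ≤ trdeg R`. Monomials in `m` algebraically independent elements force growth of degree at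
least `m`. Conversely, by Noether normalization a finite-dimensional subspace generates a
subalgebra finite over a polynomial ring in `s` algebraically independent variables, so its growth
has degree at most `s`; hence `trdeg R = GKdim R`. Finally, if `(1 - t) ^ d * P_R(t)` is bounded
near `1`, then evaluating at `t = 1 - 1 / (2 * (N + 1))`, where `t ^ N ≥ 1 / 2`, shows that
`∑_{i ≤ N} dim R_i = O(N ^ d)`, and a finite-dimensional subspace `V ⊆ R_0 + ⋯ + R_m` satisfies
`V ^ n ⊆ R_0 + ⋯ + R_{mn}`.
-/

namespace HilbertSerre

open Asymptotics MvPolynomial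

section MaximalDegree

variable (σ k : Type*) [CommSemiring k]

open scoped Pointwise in
theorem setOf_forall_le_eq_nsmul (n : ℕ) :
    {e : σ →₀ ℕ | ∀ i, e i ≤ n} = n • {e : σ →₀ ℕ | ∀ i, e i ≤ 1} := by
  induction n with
  | zero => ext e; simp [Finsupp.ext_iff]
  | succ n ih =>
    rw [succ_nsmul, ← ih]
    ext e
    refine ⟨fun he => ?_, ?_⟩
    · let b : σ →₀ ℕ := e.mapRange (min 1) (by simp)
      have hb (i : σ) : b i = min 1 (e i) := by simp [b]
      refine ⟨e - b, fun i => ?_, b, fun i => ?_, tsub_add_cancel_of_le fun i => ?_⟩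
      · have := he i
        simp only [Finsupp.tsub_apply, hb]
        omega
      · simp [hb]
      · simp [hb]
    · rintro ⟨a, ha, b, hb, rfl⟩ i
      exact add_le_add (ha i) (hb i)

theorem restrictDegree_eq_pow (n : ℕ) : restrictDegree σ k n = restrictDegree σ k 1 ^ n := by
  rw [restrictDegree, restrictDegree, ← restrictSupport_nsmul, setOf_forall_le_eq_nsmul]

theorem one_le_restrictDegree (n : ℕ) : 1 ≤ restrictDegree σ k n := by
  rw [← restrictSupport_zero]
  refine restrictSupport_mono k ?_
  rintro _ rfl _
  exact Nat.zero_le n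

theorem iSup_restrictDegree : ⨆ n, restrictDegree σ k n = ⊤ :=
  eq_top_iff.2 fun p _ => Submodule.mem_iSup_of_mem p.totalDegree <|
    restrictTotalDegree_le_restrictDegree _ _ _ ((mem_restrictTotalDegree _ _ _).2 le_rfl)

theorem finrank_restrictDegree [StrongRankCondition k] [Finite σ] (n : ℕ) :
    Module.finrank k (restrictDegree σ k n) = (n + 1) ^ Nat.card σ := by
  let e : {e : σ →₀ ℕ | ∀ i, e i ≤ n} ≃ (σ → Fin (n + 1)) :=
    { toFun := fun e i => ⟨e.1 i, Nat.lt_succ_of_le (e.2 i)⟩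
      invFun := fun g => ⟨Finsupp.equivFunOnFinite.symm fun i => (g i : ℕ),
        fun i => Nat.le_of_lt_succ (g i).2⟩
      left_inv := fun _ => by ext; simp
      right_inv := fun _ => by ext; simp }
  calc Module.finrank k (restrictDegree σ k n)
      = Nat.card {e : σ →₀ ℕ | ∀ i, e i ≤ n} :=
        Module.finrank_eq_nat_card_basis (basisRestrictSupport k _)
    _ = (n + 1) ^ Nat.card σ := by rw [Nat.card_congr e, Nat.card_fun, Nat.card_fin]

end MaximalDegree

section TranscendenceDegree

theorem natCast_le_toENat_trdeg_iff {k R : Type*} [CommRing k] [Nontrivial k] [CommRing R]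
    [Algebra k R] [FaithfulSMul k R] {n : ℕ} :
    (n : ℕ∞) ≤ Cardinal.toENat (Algebra.trdeg k R) ↔
      ∃ x : Fin n → R, AlgebraicIndependent k x := by
  rw [Cardinal.natCast_le_toENat]
  refine ⟨fun hn => ?_, fun ⟨x, hx⟩ => by simpa using hx.lift_cardinalMk_le_trdeg⟩
  obtain ⟨s, hs, hns⟩ : ∃ s : Set R, AlgebraicIndepOn k id s ∧ (n : Cardinal) ≤ Cardinal.mk s := by
    cases n with
    | zero =>
      exact ⟨∅, (algebraicIndependent_empty_iff k R).2 (FaithfulSMul.algebraMap_injective k R),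
        by simp⟩
    | succ n =>
      have hlt : (n : Cardinal) < Algebra.trdeg k R :=
        (Nat.cast_lt.2 n.lt_succ_self).trans_le hn
      obtain ⟨s, hs⟩ := exists_lt_of_lt_ciSup' hlt
      exact ⟨s, s.2, by simpa using Order.succ_le_of_lt hs⟩
  obtain ⟨f⟩ : Nonempty (Fin n ↪ s) := Cardinal.lift_mk_le'.1 (by simpa using hns)
  exact ⟨_, hs.comp f f.injective⟩

/-- Lowest-order terms: the constant coefficient of `F` lies in `Q` after evaluation at `y ∈ Q`,
hence vanishes, and `y ∉ P` can then be cancelled from `F`. -/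
theorem eq_zero_of_eval₂_mem {A R : Type*} [CommRing A] [CommRing R] {φ : A →+* R}
    {P Q : Ideal R} [P.IsPrime] (hPQ : P ≤ Q) (hφ : ∀ a, φ a ∈ Q → a = 0) {y : R} (hyQ : y ∈ Q)
    (hyP : y ∉ P) (F : Polynomial A) (hF : F.eval₂ φ y ∈ P) : F = 0 := by
  induction F using Polynomial.recOnHorner with
  | M0 => rfl
  | MC F a hF0 ha _ =>
    obtain ⟨G, rfl⟩ := Polynomial.X_dvd_iff.2 hF0
    have hmem : y * G.eval₂ φ y + φ a ∈ Q := by simpa using hPQ hF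
    exact absurd (hφ a ((Q.add_mem_iff_right (Q.mul_mem_right _ hyQ)).1 hmem)) ha
  | MX F _ ih =>
    rw [Polynomial.eval₂_mul_X] at hF
    rw [ih ((Ideal.IsPrime.mem_or_mem ‹_› hF).resolve_right hyP), zero_mul]

theorem aeval_fin_cons {k R : Type*} [CommSemiring k] [CommSemiring R] [Algebra k R] {n : ℕ}
    (y : R) (x : Fin n → R) (f : MvPolynomial (Fin (n + 1)) k) :
    aeval (Fin.cons y x : Fin (n + 1) → R) f =
      (finSuccEquiv k n f).eval₂ (aeval x : MvPolynomial (Fin n) k →ₐ[k] R).toRingHom y := by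
  induction f using MvPolynomial.induction_on with
  | C a => simp [finSuccEquiv_apply]
  | add p q hp hq => rw [map_add, map_add, Polynomial.eval₂_add, hp, hq]
  | mul_X p i hp =>
    rw [map_mul, map_mul, Polynomial.eval₂_mul, hp]
    cases i using Fin.cases <;> simp [finSuccEquiv_X_zero, finSuccEquiv_X_succ]

theorem algebraicIndependent_quotient_iff {k R : Type*} [CommRing k] [CommRing R] [Algebra k R]
    {ι : Type*} {I : Ideal R} {x : ι → R} :
    AlgebraicIndependent k (Ideal.Quotient.mkₐ k I ∘ x) ↔
      ∀ f : MvPolynomial ι k, aeval x f ∈ I → f = 0 := by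
  have haeval : aeval (Ideal.Quotient.mkₐ k I ∘ x) = (Ideal.Quotient.mkₐ k I).comp (aeval x) := by
    ext; simp
  rw [algebraicIndependent_iff, haeval]
  exact forall_congr' fun f => imp_congr_left Ideal.Quotient.eq_zero_iff_mem

variable (k : Type*) {R : Type*} [Field k] [CommRing R] [Algebra k R]

theorem exists_algebraicIndependent_quotient (n : ℕ) (p : Fin (n + 1) → PrimeSpectrum R)
    (hp : StrictMono p) :
    ∃ x : Fin n → R, AlgebraicIndependent k (Ideal.Quotient.mkₐ k (p 0).asIdeal ∘ x) := by
  induction n with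
  | zero => exact ⟨Fin.elim0, algebraicIndependent_empty_type⟩
  | succ n ih =>
    obtain ⟨x, hx⟩ := ih (fun i => p i.succ) (hp.comp Fin.strictMono_succ)
    have hlt : (p 0).asIdeal < (p 1).asIdeal := hp (by simp)
    obtain ⟨y, hy1, hy0⟩ := SetLike.exists_of_lt hlt
    refine ⟨Fin.cons y x, algebraicIndependent_quotient_iff.2 fun f hf => ?_⟩
    rw [aeval_fin_cons] at hf
    have hx' := algebraicIndependent_quotient_iff.1 hx
    exact (map_eq_zero_iff _ (finSuccEquiv k n).injective).1
      (eq_zero_of_eval₂_mem hlt.le hx' hy1 hy0 _ hf)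

theorem ringKrullDim_le_toENat_trdeg :
    ringKrullDim R ≤ ((Cardinal.toENat (Algebra.trdeg k R) : ℕ∞) : WithBot ℕ∞) := by
  refine iSup_le fun l => ?_
  obtain ⟨x, hx⟩ := exists_algebraicIndependent_quotient k l.length l l.strictMono
  have : Nontrivial R := (l 0).nontrivial
  exact WithBot.coe_le_coe.2 (natCast_le_toENat_trdeg_iff.2 ⟨x, hx.of_comp _⟩)

theorem krullDimE_le_trdegE : krullDimE R ≤ trdegE k R := by
  have hle := ringKrullDim_le_toENat_trdeg k (R := R)
  unfold krullDimE trdegE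
  cases hd : ringKrullDim R with
  | bot => exact bot_le
  | coe d =>
    rw [hd, WithBot.coe_le_coe] at hle
    exact EReal.coe_ennreal_le_coe_ennreal_iff.2 (ENat.toENNReal_le.2 hle)

end TranscendenceDegree

section Growth

theorem one_add_pow_eq_sum_range {α : Type*} [IdemSemiring α] (a : α) (n : ℕ) :
    (1 + a) ^ n = ∑ i ∈ Finset.range (n + 1), a ^ i := by
  induction n with
  | zero => simp
  | succ n ih =>
    have hone : 1 ≤ ∑ i ∈ Finset.range (n + 1), a ^ i := by
      simpa using Finset.single_le_sum_of_canonicallyOrdered (f := fun i => a ^ i)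
        (Finset.mem_range.2 n.succ_pos)
    calc (1 + a) ^ (n + 1)
        = ∑ i ∈ Finset.range (n + 1), a ^ i + ∑ i ∈ Finset.range (n + 1), a ^ (i + 1) := by
          simp only [pow_succ _ n, ih, mul_add, mul_one, Finset.sum_mul, pow_succ]
      _ = ∑ i ∈ Finset.range (n + 1), a ^ i + ∑ i ∈ Finset.range (n + 2), a ^ i := by
          rw [Finset.sum_range_succ' _ (n + 1), pow_zero, ← add_assoc, add_right_comm,
            add_eq_left_iff_le.2 hone]
      _ = ∑ i ∈ Finset.range (n + 2), a ^ i := by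
          rw [Finset.sum_range_succ _ (n + 1), ← add_assoc, add_idem]

variable {k R : Type*} [Field k] [CommRing R] [Algebra k R]

theorem growth_eq_finrank_one_add_pow (V : Submodule k R) (n : ℕ) :
    growth k V n = Module.finrank k ((1 + V) ^ n : Submodule k R) := by
  rw [growth, one_add_pow_eq_sum_range]

theorem growth_map {S : Type*} [CommRing S] [Algebra k S] {f : R →ₐ[k] S}
    (hf : Function.Injective f) (V : Submodule k R) (n : ℕ) :
    growth k (V.map f.toLinearMap) n = growth k V n := by
  have hmap : (1 + V.map f.toLinearMap) ^ n = ((1 + V) ^ n).map f.toLinearMap := by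
    rw [Submodule.map_pow, Submodule.add_eq_sup, Submodule.add_eq_sup, Submodule.map_sup,
      Submodule.map_one]
  rw [growth_eq_finrank_one_add_pow, growth_eq_finrank_one_add_pow, hmap]
  exact (Submodule.equivMapOfInjective f.toLinearMap hf _).finrank_eq.symm

theorem finrank_pow_le_growth (V : Submodule k R) [FiniteDimensional k V] (n : ℕ) :
    Module.finrank k (V ^ n : Submodule k R) ≤ growth k V n := by
  have hone : (1 : Submodule k R).FG := by
    rw [Submodule.one_eq_span]
    exact Submodule.fg_span_singleton 1
  have hfg : (1 + V).FG := hone.sup ((Submodule.fg_iff_finiteDimensional V).2 ‹_›)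
  have := (Submodule.fg_iff_finiteDimensional _).1 (hfg.pow n)
  rw [growth_eq_finrank_one_add_pow]
  exact Submodule.finrank_mono (pow_le_pow_left' le_add_self n)

theorem growth_le_finrank_of_mul_le {G : ℕ → Submodule k R} (hG : Monotone G)
    (hfin : ∀ n, FiniteDimensional k (G n)) (hone : 1 ≤ G 0) {V : Submodule k R} {d : ℕ}
    (hV : ∀ n, V * G n ≤ G (d + n)) (n : ℕ) : growth k V n ≤ Module.finrank k (G (d * n)) := by
  rw [growth_eq_finrank_one_add_pow]
  refine Submodule.finrank_mono ?_
  induction n with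
  | zero => simpa using hone
  | succ n ih =>
    calc (1 + V) ^ (n + 1) = (1 + V) * (1 + V) ^ n := pow_succ' _ _
      _ ≤ (1 + V) * G (d * n) := by gcongr
      _ = G (d * n) + V * G (d * n) := by rw [add_mul, one_mul]
      _ ≤ G (d * (n + 1)) := by
        rw [mul_add_one, add_comm (d * n)]
        exact sup_le (hG le_add_self) (hV _)

theorem exists_le_of_iSup_eq_top {k M : Type*} [Semiring k] [AddCommMonoid M] [Module k M]
    {G : ℕ → Submodule k M} (hG : Monotone G) (htop : ⨆ n, G n = ⊤) {V : Submodule k M}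
    (hV : V.FG) : ∃ n, V ≤ G n := by
  obtain ⟨s, rfl⟩ := hV
  have hmem (v : M) : ∃ n, v ∈ G n :=
    (Submodule.mem_iSup_of_directed G hG.directed_le).1 (htop ▸ Submodule.mem_top)
  choose f hf using hmem
  exact ⟨s.sup f, Submodule.span_le.2 fun v hv => hG (Finset.le_sup hv) (hf v)⟩

end Growth

section GrowthRate

/-- The exponent of polynomial growth of a subspace `V`, the quantity whose supremum over all
finite-dimensional `V` is the Gelfand-Kirillov dimension. -/
noncomputable def growthRate (k : Type*) {R : Type*} [Field k] [CommRing R] [Algebra k R]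
    (V : Submodule k R) : EReal :=
  limsup (fun n : ℕ => ((Real.log (growth k V n) / Real.log n : ℝ) : EReal)) atTop

theorem tendsto_log_const_mul_pow_div_log {C : ℝ} (hC : 0 < C) (m : ℕ) :
    Tendsto (fun n : ℕ => ((Real.log (C * (n : ℝ) ^ m) / Real.log n : ℝ) : EReal)) atTop
      (𝓝 m) := by
  have hlog : Tendsto (fun n : ℕ => Real.log (n : ℝ)) atTop atTop :=
    Real.tendsto_log_atTop.comp tendsto_natCast_atTop_atTop
  have hlim : Tendsto (fun n : ℕ => Real.log C / Real.log n + m) atTop (𝓝 (m : ℝ)) := by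
    simpa using (hlog.const_div_atTop (Real.log C)).add_const (m : ℝ)
  refine ((continuous_coe_real_ereal.tendsto _).comp hlim).congr' ?_
  filter_upwards [eventually_gt_atTop 1] with n hn
  have hn' : (1 : ℝ) < n := by exact_mod_cast hn
  have hpos := Real.log_pos hn'
  rw [Function.comp_apply, Real.log_mul hC.ne' (by positivity), Real.log_pow]
  field_simp

theorem limsup_log_div_log_le_of_isBigO {u : ℕ → ℝ} {m : ℕ}
    (h : u =O[atTop] fun n => (n : ℝ) ^ m) :
    limsup (fun n : ℕ => ((Real.log (u n) / Real.log n : ℝ) : EReal)) atTop ≤ m := by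
  obtain ⟨C, hC, hu⟩ := h.exists_pos
  rw [← (tendsto_log_const_mul_pow_div_log (lt_max_of_lt_left hC : 0 < max C 1) m).limsup_eq]
  refine limsup_le_limsup ?_
  filter_upwards [hu.bound, eventually_gt_atTop 1] with n hn hn1
  have hn1' : (1 : ℝ) ≤ n := by exact_mod_cast hn1.le
  have hle : |u n| ≤ max C 1 * (n : ℝ) ^ m := by
    rw [Real.norm_eq_abs, Real.norm_of_nonneg (by positivity)] at hn
    exact hn.trans (by gcongr; exact le_max_left C 1)
  refine EReal.coe_le_coe_iff.2 (div_le_div_of_nonneg_right ?_ (Real.log_nonneg hn1'))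
  rcases eq_or_ne (u n) 0 with h0 | h0
  · rw [h0, Real.log_zero]
    exact Real.log_nonneg (one_le_mul_of_one_le_of_one_le (le_max_right C 1) (one_le_pow₀ hn1'))
  · rw [← Real.log_abs]
    exact Real.log_le_log (abs_pos.2 h0) hle

theorem le_limsup_log_div_log {u : ℕ → ℝ} {m : ℕ} (h : ∀ᶠ n : ℕ in atTop, (n : ℝ) ^ m ≤ u n) :
    (m : EReal) ≤
      limsup (fun n : ℕ => ((Real.log (u n) / Real.log n : ℝ) : EReal)) atTop := by
  rw [← (tendsto_log_const_mul_pow_div_log one_pos m).limsup_eq]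
  refine limsup_le_limsup ?_
  filter_upwards [h, eventually_ge_atTop 1] with n hn hn1
  have hn1' : (1 : ℝ) ≤ n := by exact_mod_cast hn1
  rw [one_mul]
  exact EReal.coe_le_coe_iff.2 (div_le_div_of_nonneg_right
    (Real.log_le_log (by positivity) hn) (Real.log_nonneg hn1'))

theorem isBigO_succ_pow (m : ℕ) :
    (fun n : ℕ => ((n + 1 : ℕ) : ℝ) ^ m) =O[atTop] fun n : ℕ => (n : ℝ) ^ m := by
  refine IsBigO.pow ?_ m
  simp only [Nat.cast_succ]
  have hone : (fun _ : ℕ => (1 : ℝ)) =O[atTop] fun n : ℕ => (n : ℝ) :=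
    (isLittleO_const_id_atTop (1 : ℝ)).isBigO.comp_tendsto tendsto_natCast_atTop_atTop
  exact (isBigO_refl _ _).add hone

variable {k R : Type*} [Field k] [CommRing R] [Algebra k R]

theorem growthRate_le_of_mul_le {G : ℕ → Submodule k R} (hG : Monotone G)
    (hfin : ∀ n, FiniteDimensional k (G n)) (hone : 1 ≤ G 0) {m : ℕ}
    (hrank : (fun n => (Module.finrank k (G n) : ℝ)) =O[atTop] fun n => (n : ℝ) ^ m)
    {V : Submodule k R} {d : ℕ} (hV : ∀ n, V * G n ≤ G (d + n)) : growthRate k V ≤ m := by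
  have hV' (n : ℕ) : V * G n ≤ G (d + 1 + n) := (hV n).trans (hG (by omega))
  have hgrowth : (fun n => (growth k V n : ℝ)) =O[atTop]
      fun n => (Module.finrank k (G ((d + 1) * n)) : ℝ) :=
    .of_norm_le fun n => by
      simpa using growth_le_finrank_of_mul_le hG hfin hone hV' n
  have hscale : Tendsto (fun n => (d + 1) * n) atTop atTop :=
    tendsto_id.const_mul_atTop' d.succ_pos
  refine limsup_log_div_log_le_of_isBigO
    ((hgrowth.trans (hrank.comp_tendsto hscale)).trans ?_)
  refine .of_bound (((d + 1 : ℕ) : ℝ) ^ m) (.of_forall fun n => ?_)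
  rw [Function.comp_apply, Nat.cast_mul, mul_pow, norm_mul, Real.norm_of_nonneg (by positivity)]

end GrowthRate

section TrdegEqGKdim

variable {k R : Type*} [Field k] [CommRing R] [Algebra k R]

theorem map_restrictDegree_one_pow {σ k R : Type*} [CommSemiring k] [CommSemiring R] [Algebra k R]
    (φ : MvPolynomial σ k →ₐ[k] R) (n : ℕ) :
    (restrictDegree σ k 1).map φ.toLinearMap ^ n = (restrictDegree σ k n).map φ.toLinearMap := by
  rw [restrictDegree_eq_pow σ k n, Submodule.map_pow]

theorem natCast_le_gkDim_of_algebraicIndependent {m : ℕ} {x : Fin m → R}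
    (hx : AlgebraicIndependent k x) : (m : EReal) ≤ gkDim k R := by
  let V : Submodule k R := (restrictDegree (Fin m) k 1).map (aeval x).toLinearMap
  have hV : FiniteDimensional k V := Module.Finite.map _ _
  have hpow (n : ℕ) : Module.finrank k (V ^ n : Submodule k R) = (n + 1) ^ m := by
    rw [map_restrictDegree_one_pow,
      ← (Submodule.equivMapOfInjective (aeval x).toLinearMap hx _).finrank_eq,
      finrank_restrictDegree, Nat.card_fin]
  refine (le_limsup_log_div_log (u := fun n => growth k V n) (.of_forall fun n => ?_)).trans
    (le_iSup₂ (f := fun V _ => growthRate k V) V hV)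
  calc (n : ℝ) ^ m ≤ ((n + 1) ^ m : ℕ) := by exact_mod_cast Nat.pow_le_pow_left n.le_succ m
    _ ≤ growth k V n := by exact_mod_cast hpow n ▸ finrank_pow_le_growth V n

theorem finrank_mul_le (V W : Submodule k R) [FiniteDimensional k V] [FiniteDimensional k W] :
    Module.finrank k (V * W : Submodule k R) ≤ Module.finrank k V * Module.finrank k W := by
  rw [← Submodule.mulMap_range, ← Module.finrank_tensorProduct]
  exact LinearMap.finrank_range_le _

theorem finrank_map_restrictDegree_mul_le {σ : Type*} [Finite σ] (φ : MvPolynomial σ k →ₐ[k] R)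
    (S : Submodule k R) [FiniteDimensional k S] (n : ℕ) :
    Module.finrank k ((restrictDegree σ k n).map φ.toLinearMap * S : Submodule k R) ≤
      (n + 1) ^ Nat.card σ * Module.finrank k S := by
  rw [← finrank_restrictDegree σ k n]
  exact (finrank_mul_le _ _).trans (Nat.mul_le_mul_right _ (Submodule.finrank_map_le _ _))

theorem exists_fg_range_mul_eq_top (k B A : Type*) [CommSemiring k] [CommSemiring B]
    [CommSemiring A] [Algebra k A] [Algebra k B] [Algebra B A] [IsScalarTower k B A]
    [Module.Finite B A] :
    ∃ S : Submodule k A, S.FG ∧ 1 ≤ S ∧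
      Subalgebra.toSubmodule (IsScalarTower.toAlgHom k B A).range * S = ⊤ := by
  classical
  obtain ⟨u, hu⟩ := (Module.Finite.fg_top : (⊤ : Submodule B A).FG)
  refine ⟨.span k (insert 1 u : Finset A), ⟨_, rfl⟩,
    Submodule.one_le.2 (Submodule.subset_span (by simp)), eq_top_iff.2 fun a _ => ?_⟩
  have ha : a ∈ Submodule.span B (u : Set A) := hu ▸ Submodule.mem_top
  induction ha using Submodule.span_induction with
  | mem a ha =>
    rw [← one_mul a]
    exact Submodule.mul_mem_mul (one_mem (IsScalarTower.toAlgHom k B A).range)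
      (Submodule.subset_span (by simp [ha]))
  | zero => exact zero_mem _
  | add a b _ _ ha hb => exact add_mem (ha trivial) (hb trivial)
  | smul p a _ ha =>
    rw [Algebra.smul_def, ← Subalgebra.isIdempotentElem_toSubmodule _ |>.eq, mul_assoc]
    exact Submodule.mul_mem_mul ⟨p, rfl⟩ (ha trivial)

theorem growthRate_le_card_of_finite (σ : Type*) [Finite σ] [Algebra (MvPolynomial σ k) R]
    [IsScalarTower k (MvPolynomial σ k) R] [Module.Finite (MvPolynomial σ k) R]
    (V : Submodule k R) [FiniteDimensional k V] : growthRate k V ≤ Nat.card σ := by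
  let φ := IsScalarTower.toAlgHom k (MvPolynomial σ k) R
  let W : Submodule k R := (restrictDegree σ k 1).map φ.toLinearMap
  have hWpow (n : ℕ) : W ^ n = (restrictDegree σ k n).map φ.toLinearMap :=
    map_restrictDegree_one_pow φ n
  have hWone : 1 ≤ W :=
    Submodule.map_one (A := MvPolynomial σ k) φ ▸ Submodule.map_mono (one_le_restrictDegree σ k 1)
  have hWfin (n : ℕ) : FiniteDimensional k (W ^ n : Submodule k R) :=
    hWpow n ▸ Module.Finite.map _ _
  obtain ⟨S, hSfg, hSone, htop⟩ := exists_fg_range_mul_eq_top k (MvPolynomial σ k) R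
  have hSfin := (Submodule.fg_iff_finiteDimensional S).1 hSfg
  have hmono : Monotone fun n => W ^ n * S := fun a b hab =>
    mul_le_mul_left (pow_le_pow_right' hWone hab) S
  have hiSup : ⨆ n, W ^ n * S = ⊤ := by
    simp only [hWpow]
    rw [← Submodule.iSup_mul, ← Submodule.map_iSup, iSup_restrictDegree, Submodule.map_top,
      ← htop]
    rfl
  have hVfg : V.FG := (Submodule.fg_iff_finiteDimensional V).2 ‹_›
  obtain ⟨d, hd⟩ := exists_le_of_iSup_eq_top hmono hiSup (hVfg.mul hSfg)
  have hrank (n : ℕ) : Module.finrank k (W ^ n * S : Submodule k R) ≤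
      Module.finrank k S * (n + 1) ^ Nat.card σ := by
    rw [hWpow, mul_comm (Module.finrank k S)]
    exact finrank_map_restrictDegree_mul_le φ S n
  refine growthRate_le_of_mul_le hmono (fun n => ?_) ?_ (.trans ?_ (isBigO_succ_pow _)) (d := d)
    fun n => ?_
  · exact (Submodule.fg_iff_finiteDimensional _).1
      (((Submodule.fg_iff_finiteDimensional _).2 (hWfin n)).mul hSfg)
  · simpa using hSone
  · refine .of_bound (Module.finrank k S) (.of_forall fun n => ?_)
    simp only [← Nat.cast_pow, Real.norm_natCast]
    exact mod_cast hrank n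
  · calc V * (W ^ n * S) = W ^ n * (V * S) := mul_left_comm _ _ _
      _ ≤ W ^ n * (W ^ d * S) := by gcongr
      _ = W ^ (d + n) * S := by rw [add_comm, pow_add, mul_assoc]

theorem exists_algebraicIndependent_growthRate_le [Nontrivial R] (V : Submodule k R)
    [FiniteDimensional k V] :
    ∃ (s : ℕ) (x : Fin s → R), AlgebraicIndependent k x ∧ growthRate k V ≤ s := by
  obtain ⟨t, rfl⟩ := (Submodule.fg_iff_finiteDimensional V).2 ‹_›
  let A := Algebra.adjoin k (t : Set R)
  have : Algebra.FiniteType k A := (Subalgebra.fg_iff_finiteType A).1 ⟨t, rfl⟩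
  obtain ⟨s, g, hg, hgfin⟩ := exists_finite_inj_algHom_of_fg k A
  have hinj : Function.Injective (A.val.comp g) := Subtype.val_injective.comp hg
  refine ⟨s, A.val.comp g ∘ X, (algebraicIndependent_X (Fin s) k).map' hinj, ?_⟩
  let W : Submodule k A := (Submodule.span k t).comap A.val.toLinearMap
  have hWV : W.map A.val.toLinearMap = Submodule.span k t := by
    refine Submodule.map_comap_eq_self (Submodule.span_le.2 fun x hx => ?_)
    exact ⟨⟨x, Algebra.subset_adjoin hx⟩, rfl⟩
  have : FiniteDimensional k W := (Submodule.fg_iff_finiteDimensional W).1 <|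
    Submodule.fg_of_fg_map_injective A.val.toLinearMap Subtype.val_injective ⟨t, hWV.symm⟩
  have hgrowth : growthRate k (Submodule.span k (t : Set R)) = growthRate k W := by
    simp only [growthRate, ← hWV, growth_map (f := A.val) Subtype.val_injective]
  replace hgfin : g.toRingHom.Finite := hgfin
  algebraize [g.toRingHom]
  have : IsScalarTower k (MvPolynomial (Fin s) k) A :=
    .of_algebraMap_eq fun c => (g.commutes c).symm
  rw [hgrowth]
  simpa using growthRate_le_card_of_finite (Fin s) W

theorem coe_enat_le_of_forall_natCast_le {a : ℕ∞} {y : EReal}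
    (h : ∀ n : ℕ, (n : ℕ∞) ≤ a → (n : EReal) ≤ y) : ((a : ℝ≥0∞) : EReal) ≤ y := by
  cases a with
  | top =>
    refine le_of_le_of_eq le_top (Eq.symm ?_)
    refine (EReal.eq_top_iff_forall_lt y).2 fun r => ?_
    obtain ⟨n, hn⟩ := exists_nat_gt r
    exact (EReal.coe_lt_coe_iff.2 hn).trans_le (h n le_top)
  | coe n => exact h n le_rfl

theorem trdegE_eq_gkDim [Nontrivial R] : trdegE k R = gkDim k R := by
  refine le_antisymm (coe_enat_le_of_forall_natCast_le fun n hn => ?_) (iSup₂_le fun V _ => ?_)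
  · obtain ⟨x, hx⟩ := natCast_le_toENat_trdeg_iff.1 hn
    exact natCast_le_gkDim_of_algebraicIndependent hx
  · obtain ⟨s, x, hx, hs⟩ := exists_algebraicIndependent_growthRate_le V
    have hle : (s : ℕ∞) ≤ Cardinal.toENat (Algebra.trdeg k R) :=
      natCast_le_toENat_trdeg_iff.2 ⟨x, hx⟩
    exact hs.trans (EReal.coe_ennreal_le_coe_ennreal_iff.2 (ENat.toENNReal_le.2 hle))

end TrdegEqGKdim

section Graded

theorem half_le_one_sub_pow (n : ℕ) : 1 / 2 ≤ (1 - 1 / (2 * ((n : ℝ) + 1))) ^ n := by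
  have hε : 1 / (2 * ((n : ℝ) + 1)) ≤ 1 / 2 := by gcongr; linarith
  have hnε : (n : ℝ) * (1 / (2 * ((n : ℝ) + 1))) ≤ 1 / 2 := by
    rw [mul_one_div, div_le_div_iff₀ (by positivity) two_pos]
    linarith
  have hbernoulli := one_add_mul_le_pow (a := -(1 / (2 * ((n : ℝ) + 1)))) (by linarith) n
  rw [← sub_eq_add_neg] at hbernoulli
  linarith

theorem pow_mul_sum_range_le_tsum {a : ℕ → ℝ} (ha : ∀ n, 0 ≤ a n) {t : ℝ} (ht0 : 0 ≤ t)
    (ht1 : t ≤ 1) (hsum : Summable fun n => a n * t ^ n) (N : ℕ) :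
    t ^ N * ∑ i ∈ Finset.range (N + 1), a i ≤ ∑' n, a n * t ^ n :=
  calc t ^ N * ∑ i ∈ Finset.range (N + 1), a i
      = ∑ i ∈ Finset.range (N + 1), a i * t ^ N := by rw [mul_comm, Finset.sum_mul]
    _ ≤ ∑ i ∈ Finset.range (N + 1), a i * t ^ i := by
      refine Finset.sum_le_sum fun i hi => mul_le_mul_of_nonneg_left ?_ (ha i)
      exact pow_le_pow_of_le_one ht0 ht1 (Nat.le_of_lt_succ (Finset.mem_range.1 hi))
    _ ≤ ∑' n, a n * t ^ n := hsum.sum_le_tsum _ fun i _ => mul_nonneg (ha i) (pow_nonneg ht0 i)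

theorem isBigO_sum_range_of_isBigO_tsum {a : ℕ → ℝ} (ha : ∀ n, 0 ≤ a n)
    (hsum : ∀ t : ℝ, 0 ≤ t → t < 1 → Summable fun n => a n * t ^ n) {d : ℕ}
    (hbound : (fun t : ℝ => (1 - t) ^ d * ∑' n, a n * t ^ n) =O[𝓝[<] 1] fun _ => (1 : ℝ)) :
    (fun N => ∑ i ∈ Finset.range (N + 1), a i) =O[atTop] fun N => (N : ℝ) ^ d := by
  let t (N : ℕ) : ℝ := 1 - 1 / (2 * ((N : ℝ) + 1))
  have ht1 (N : ℕ) : t N < 1 := sub_lt_self 1 (by positivity)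
  have ht_lim : Tendsto t atTop (𝓝[<] 1) := by
    refine tendsto_nhdsWithin_iff.2 ⟨?_, .of_forall ht1⟩
    have hlim : Tendsto (fun N : ℕ => 2 * ((N : ℝ) + 1)) atTop atTop :=
      (tendsto_atTop_add_const_right _ 1 tendsto_natCast_atTop_atTop).const_mul_atTop two_pos
    simpa only [sub_zero] using (hlim.const_div_atTop 1).const_sub 1
  have ht0 (N : ℕ) : 0 ≤ t N := by
    refine sub_nonneg.2 ((div_le_one (by positivity)).2 ?_)
    linarith [N.cast_nonneg (α := ℝ)]
  obtain ⟨C, hC⟩ := (hbound.comp_tendsto ht_lim).bound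
  refine IsBigO.trans ?_ (isBigO_succ_pow d)
  refine .of_bound (2 * C * 2 ^ d) (hC.mono fun N hN => ?_)
  have hpartial : ∑ i ∈ Finset.range (N + 1), a i ≤ 2 * ∑' n, a n * t N ^ n := by
    have hle := pow_mul_sum_range_le_tsum ha (ht0 N) (ht1 N).le (hsum _ (ht0 N) (ht1 N)) N
    have hnonneg : 0 ≤ ∑ i ∈ Finset.range (N + 1), a i := Finset.sum_nonneg fun i _ => ha i
    have := mul_le_mul_of_nonneg_right (half_le_one_sub_pow N) hnonneg
    linarith
  have htsum : ∑' n, a n * t N ^ n ≤ C * (2 * ((N : ℝ) + 1)) ^ d := by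
    have hsub : 1 - t N = (2 * ((N : ℝ) + 1))⁻¹ := by simp only [t]; ring
    have hle := (le_abs_self _).trans hN
    simp only [Function.comp_apply, norm_one, mul_one, hsub, inv_pow] at hle
    rwa [inv_mul_le_iff₀ (by positivity), mul_comm] at hle
  rw [Real.norm_of_nonneg (Finset.sum_nonneg fun i _ => ha i),
    Real.norm_of_nonneg (by positivity), Nat.cast_succ]
  calc ∑ i ∈ Finset.range (N + 1), a i ≤ 2 * (C * (2 * ((N : ℝ) + 1)) ^ d) := by linarith
    _ = 2 * C * 2 ^ d * ((N : ℝ) + 1) ^ d := by rw [mul_pow]; ring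

section PartialSups

variable {K M : Type*} [DivisionRing K] [AddCommGroup M] [Module K M] {f : ℕ → Submodule K M}

theorem finiteDimensional_partialSups (hf : ∀ n, FiniteDimensional K (f n)) (n : ℕ) :
    FiniteDimensional K (partialSups f n : Submodule K M) := by
  induction n with
  | zero => exact partialSups_zero f ▸ hf 0
  | succ n ih =>
    rw [partialSups_add_one]
    infer_instance

theorem finrank_partialSups_le (hf : ∀ n, FiniteDimensional K (f n)) (n : ℕ) :
    Module.finrank K (partialSups f n : Submodule K M) ≤
      ∑ i ∈ Finset.range (n + 1), Module.finrank K (f i) := by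
  induction n with
  | zero => rw [partialSups_zero, zero_add, Finset.sum_range_one]
  | succ n ih =>
    have := finiteDimensional_partialSups hf n
    rw [partialSups_add_one, Finset.sum_range_succ]
    exact (Submodule.finrank_add_le_finrank_add_finrank _ _).trans (by gcongr)

theorem partialSups_mul_le {k R : Type*} [CommSemiring k] [Semiring R] [Algebra k R]
    (𝒜 : ℕ → Submodule k R) [SetLike.GradedMonoid 𝒜] (m n : ℕ) :
    partialSups 𝒜 m * partialSups 𝒜 n ≤ partialSups 𝒜 (m + n) := by
  simp only [partialSups_eq_biSup, Submodule.iSup_mul, Submodule.mul_iSup, iSup_le_iff]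
  intro j hj i hi
  refine (Submodule.mul_le.2 fun x hx y hy => SetLike.mul_mem_graded hx hy).trans ?_
  exact le_iSup₂_of_le (i + j) (add_le_add hi hj) le_rfl

end PartialSups

variable {k R : Type*} [Field k] [CommRing R] [Algebra k R] {𝒜 : ℕ → Submodule k R}

theorem IsHilbertSerre.summable (h : IsHilbertSerre k 𝒜) {t : ℝ} (ht0 : 0 ≤ t) (ht1 : t < 1) :
    Summable fun n => hilbertCoeff k 𝒜 n * t ^ n := by
  lift t to NNReal using ht0
  have hlt : (t : ℝ≥0∞) < (FormalMultilinearSeries.ofScalars ℝ (hilbertCoeff k 𝒜)).radius :=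
    lt_of_lt_of_le (by exact_mod_cast ht1) h.one_le_radius
  refine (FormalMultilinearSeries.summable_norm_mul_pow _ hlt).congr fun n => ?_
  rw [FormalMultilinearSeries.ofScalars_norm, hilbertCoeff, Real.norm_natCast]

theorem IsHilbertSerre.gkDim_le [GradedAlgebra 𝒜] (h : IsHilbertSerre k 𝒜) :
    gkDim k R ≤ ((hilbertSerreDim k 𝒜 : ℝ) : EReal) := by
  obtain ⟨L, hL⟩ : hilbertSerreDim k 𝒜 ∈ poleOrders k 𝒜 := Nat.sInf_mem h.poleOrders_nonempty
  have hpartial := isBigO_sum_range_of_isBigO_tsum (fun n => Nat.cast_nonneg _)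
    (fun t => h.summable) (hL.isBigO_one ℝ)
  have hrank : (fun n => (Module.finrank k (partialSups 𝒜 n : Submodule k R) : ℝ)) =O[atTop]
      fun n => (n : ℝ) ^ hilbertSerreDim k 𝒜 := by
    refine .trans (.of_norm_le fun n => ?_) hpartial
    rw [Real.norm_natCast]
    exact_mod_cast finrank_partialSups_le h.finiteDimensional n
  have htop : ⨆ n, partialSups 𝒜 n = ⊤ := by
    rw [iSup_partialSups_eq]
    exact (DirectSum.Decomposition.isInternal 𝒜).submodule_iSup_eq_top
  have hone : 1 ≤ partialSups 𝒜 0 := by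
    simpa only [partialSups_zero, Submodule.one_le] using SetLike.one_mem_graded 𝒜
  refine iSup₂_le fun V hV => ?_
  obtain ⟨d, hd⟩ := exists_le_of_iSup_eq_top (partialSups 𝒜).monotone htop
    ((Submodule.fg_iff_finiteDimensional V).2 hV)
  refine growthRate_le_of_mul_le (partialSups 𝒜).monotone
    (finiteDimensional_partialSups h.finiteDimensional) hone hrank (d := d) fun n => ?_
  exact (mul_le_mul_left hd _).trans (partialSups_mul_le 𝒜 d n)

end Graded

end HilbertSerre

theorem theorem4p6_general {k R : Type*} [Field k] [CommRing R] [Nontrivial R] [Algebra k R]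
    (𝒜 : ℕ → Submodule k R) [GradedAlgebra 𝒜] (hR : HilbertSerre.IsHilbertSerre k 𝒜) :
    HilbertSerre.krullDimE R ≤ HilbertSerre.trdegE k R ∧
      HilbertSerre.trdegE k R = HilbertSerre.gkDim k R ∧
      HilbertSerre.gkDim k R ≤ ((HilbertSerre.hilbertSerreDim k 𝒜 : ℝ) : EReal) :=
  ⟨HilbertSerre.krullDimE_le_trdegE k, HilbertSerre.trdegE_eq_gkDim, hR.gkDim_le⟩

theorem theorem4p6 {k R : Type*} [Field k] [CommRing R] [Algebra k R]
    (𝒜 : ℕ → Submodule k R) [GradedAlgebra 𝒜]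
    (h0 : Function.Bijective (algebraMap k (𝒜 0)))
    (hR : HilbertSerre.IsHilbertSerre k 𝒜) :
    (HilbertSerre.krullDimE R ≤ HilbertSerre.gkDim k R ∧
      HilbertSerre.gkDim k R ≤ ((HilbertSerre.hilbertSerreDim k 𝒜 : ℝ) : EReal)) ∧
    (IsDomain R →
      HilbertSerre.krullDimE R ≤ HilbertSerre.trdegE k R ∧
      HilbertSerre.trdegE k R = HilbertSerre.gkDim k R ∧
      HilbertSerre.gkDim k R ≤ ((HilbertSerre.hilbertSerreDim k 𝒜 : ℝ) : EReal)) := by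
  have : Nontrivial (𝒜 0) := h0.injective.nontrivial
  have : Nontrivial R := (Subtype.val_injective : Function.Injective ((↑) : 𝒜 0 → R)).nontrivial
  obtain ⟨hdim, htrdeg, hgk⟩ := theorem4p6_general 𝒜 hR
  exact ⟨⟨htrdeg ▸ hdim, hgk⟩, fun _ => ⟨hdim, htrdeg, hgk⟩⟩
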